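/- **Setting.** Let $\mathcal A$ be a standard Borel action space. Mean vectors $\bm\mu=(\mu_a)_{a\in\mathcal A}$ range over a standard Borel space $\mathcal M$ of vectors in $\mathbb R^{\mathcal A}$, and reward vectors over a measurable space $\mathcal V$ of such vectors, with the evaluations $(\bm\mu,a)\mapsto\mu_a$ and $(\mathbf r,a)\mapsto r_a$ measurable (for countable $\mathcal A$ one may take $\mathcal M=\mathcal V=\mathbb R^{\mathcal A}$). Let $\mathcal D(\cdot)$ be a Markov kernel from $\mathcal M$ to $\mathcal V$ with $E_{\mathbf r\sim\mathcal D(\bm\mu)}[r_a]=\mu_a$ for all $\bm\mu,a$, and let $(P_\theta)_{\theta\in\Theta}$ be a family of probability measures (priors) on $\mathcal M$. Given a prior $P_\theta$ and an algorithm $\mathsf{alg}$, draw $\bm\mu\sim P_\theta$; then, at each step $h=1,2,\dots$, the algorithm draws an action $a_h$ from a distribution that depends only on the partial trajectory $\tau_{h-1}=(a_1,r_1,\dots,a_{h-1},r_{h-1})$, an independent reward vector $\mathbf r_h\sim\mathcal D(\bm\mu)$ is drawn, and $r_h=r_{h,a_h}$ is observed. Write $P_{\theta,\mathsf{alg}}$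 for the joint law of $\bm\mu$ and the trajectory, and, for a horizon $H\in\mathbb N$, $$R(\theta,\mathsf{alg})=E_{\theta,\mathsf{alg}}\Big[\sum_{h=1}^H r_h\Big].$$ For each $\theta$ let $P_\theta[\,\cdot\mid\tau_{h}]$ be a version of the posterior of $\bm\mu$: a Markov kernel from trajectories to $\mathcal M$ that, for every algorithm $\mathsf{alg}$, is a regular conditional distribution of $\bm\mu$ given $\tau_{h}$ under $P_{\theta,\mathsf{alg}}$ (such a version exists; off the support of the prior it is arbitrary). *Thompson sampling* $\mathsf{TS}(\theta)$ draws at each step $\tilde{\bm\mu}_h\sim P_\theta[\,\cdot\mid\tau_{h-1}]$ and plays $a_h\in\arg\max_a\tilde\mu_{h,a}$, with a fixed measurable, possibly randomized, tie-breaking rule that does not depend on $\theta$ (where no maximizer exists, the rule may pick any action). Let $\mathrm{TV}(P,Q)=\sup_{E}|P[E]-Q[E]|$ over measurable $E$. The prior $P_\theta$ is *$B$-bounded* if $\sup_a\mu_a-\inf_a\mu_a\le B$ for $P_\theta$-almost every $\bm\mu$. **Statement.** Let $\theta,\theta'\in\Theta$, $H\in\mathbb N$ and $B\in\mathbb R$,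 let $P_\theta$ be $B$-bounded, and suppose that $R(\theta,\mathsf{TS}(\theta))$ and $R(\theta,\mathsf{TS}(\theta'))$ are well defined, in the sense that $E_{\theta,\mathsf{TS}(\theta)}|r_h|<\infty$ and $E_{\theta,\mathsf{TS}(\theta')}|r_h|<\infty$ for $1\le h\le H$. Then $$\big|R(\theta,\mathsf{TS}(\theta))-R(\theta,\mathsf{TS}(\theta'))\big|\;\le\;2H^2\cdot\mathrm{TV}(P_\theta,P_{\theta'})\cdot B .$$ -/

import Mathlib

open MeasureTheory ProbabilityTheory

noncomputable section

/-- The total variation distance `sup_E |P E - Q E|` over measurable events `E`. -/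
def tvDist {Ω : Type*} [MeasurableSpace Ω] (P Q : Measure Ω) : ℝ :=
  ⨆ E : {E : Set Ω // MeasurableSet E}, |P.real E.1 - Q.real E.1|

/-- The diameter `sup_a μ_a - inf_a μ_a` of a vector, as an extended real, so that it is `⊤`
when the coordinates are not bounded. -/
def vecDiam {A : Type*} (μ : A → ℝ) : EReal :=
  (⨆ a, (μ a : EReal)) - ⨅ a, (μ a : EReal)

/-- The set of maximizing actions of a vector. -/
def argmaxSet {A : Type*} (μ : A → ℝ) : Set A := {a | ∀ b, μ b ≤ μ a}

/-- Partial trajectories `(a₁, r₁, …, a_h, r_h)`. -/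
abbrev Traj (A : Type*) (h : ℕ) : Type _ := Fin h → A × ℝ

/-- A (randomized) bandit algorithm: after the partial trajectory `τ` of length `h`, the next
action is drawn from `act h τ`. -/
structure BanditAlg (A : Type*) [MeasurableSpace A] where
  act : ∀ h : ℕ, Kernel (Traj A h) A
  isMarkov : ∀ h, IsMarkovKernel (act h)

/-- The reward model of a bandit with action space `A`. The points of `M` are the mean vectors,
`mean m : A → ℝ` being the vector itself; the points of `V` are the reward vectors, `reward v`
being the vector itself; `D m` is the law of the reward vector when the mean vector is `m`, and
its mean is `mean m`. For countable `A` one takes `M = V = (A → ℝ)` with `mean = reward = id`;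
for uncountable `A` the product `σ`-algebra on `A → ℝ` does not make evaluation measurable, and
`M`, `V` are spaces of vectors for which it is (such as continuous functions on a compact `A`). -/
structure BanditModel (A M V : Type*) [MeasurableSpace A] [MeasurableSpace M]
    [MeasurableSpace V] where
  mean : M → A → ℝ
  measurable_mean : Measurable (fun p : M × A => mean p.1 p.2)
  reward : V → A → ℝ
  measurable_reward : Measurable (fun p : V × A => reward p.1 p.2)
  D : Kernel M V
  isMarkov : IsMarkovKernel D
  integrable_reward : ∀ m a, Integrable (fun v => reward v a) (D m)
  integral_reward : ∀ m a, ∫ v, reward v a ∂(D m) = mean m a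

namespace BanditModel

variable {A M V : Type*} [MeasurableSpace A] [MeasurableSpace M] [MeasurableSpace V]

/-- One step of the protocol: given the mean vector and the trajectory so far, the algorithm draws
an action `a`, independently a reward vector `v` is drawn from `D m`, and `(a, v_a)` is
observed. -/
def step (S : BanditModel A M V) (alg : BanditAlg A) (h : ℕ) :
    Kernel (M × Traj A h) (A × ℝ) :=
  ((alg.act h).prodMkLeft M ×ₖ S.D.prodMkRight (Traj A h)).map
    (fun q : A × V => (q.1, S.reward q.2 q.1))

/-- The joint law of the mean vector, drawn from the prior `P`, and of the trajectory of length `h`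
that the algorithm generates. -/
def law (S : BanditModel A M V) (P : Measure M) (alg : BanditAlg A) :
    ∀ h : ℕ, Measure (M × Traj A h)
  | 0 => P.map (fun m => (m, Fin.elim0))
  | h + 1 => (law S P alg h ⊗ₘ S.step alg h).map
      (fun p => (p.1.1, (Fin.snoc p.1.2 p.2 : Traj A (h + 1))))

/-- The expected cumulative reward over the horizon `H` of an algorithm on the prior `P`. -/
def R (S : BanditModel A M V) (P : Measure M) (alg : BanditAlg A) (H : ℕ) : ℝ :=
  ∫ p, ∑ i : Fin H, (p.2 i).2 ∂(S.law P alg H)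

/-- The rewards observed up to the horizon have finite expected absolute value, so that the
expected cumulative reward is well defined. -/
def FiniteReward (S : BanditModel A M V) (P : Measure M) (alg : BanditAlg A) (H : ℕ) : Prop :=
  ∀ i : Fin H, Integrable (fun p : M × Traj A H => (p.2 i).2) (S.law P alg H)

/-- The prior `P` is `B`-bounded: the diameter of the mean vector is almost surely at most `B`. -/
def IsBoundedPrior (S : BanditModel A M V) (P : Measure M) (B : ℝ) : Prop :=
  ∀ᵐ m ∂P, vecDiam (S.mean m) ≤ (B : EReal)

/-- `κ` is a version of the posterior of the mean vector given the partial trajectory, under the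
prior `P`: whichever algorithm collects the data, `κ h` is a regular conditional distribution of
the mean vector given the trajectory of length `h`. (On trajectories outside the support of the
prior `κ` is arbitrary; such a `κ` exists by `exists_isPosterior`.) -/
def IsPosterior (S : BanditModel A M V) (P : Measure M) (κ : ∀ h : ℕ, Kernel (Traj A h) M) :
    Prop :=
  ∀ (alg : BanditAlg A) (h : ℕ),
    (S.law P alg h).map Prod.swap = (S.law P alg h).snd ⊗ₘ κ h

/-- `sel` is a (possibly randomized) tie-breaking rule for the maximization of the coordinates of a
mean vector: if there are maximizing actions, it picks one of them. -/
def IsArgmaxRule (S : BanditModel A M V) (sel : Kernel M A) : Prop :=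
  ∀ m, (argmaxSet (S.mean m)).Nonempty → ∀ᵐ a ∂(sel m), a ∈ argmaxSet (S.mean m)

end BanditModel

/-- Thompson sampling with posterior `κ`: at each step it draws a mean vector from the posterior
given the partial trajectory and plays a maximizing action of it, chosen by `sel`. -/
def thompsonSampling {A M : Type*} [MeasurableSpace A] [MeasurableSpace M]
    (κ : ∀ h : ℕ, Kernel (Traj A h) M) [∀ h, IsMarkovKernel (κ h)]
    (sel : Kernel M A) [IsMarkovKernel sel] : BanditAlg A where
  act h := sel ∘ₖ κ h
  isMarkov _ := inferInstance

namespace BanditModel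

variable {A M V : Type*} [MeasurableSpace A] [MeasurableSpace M] [MeasurableSpace V]

theorem measurable_snoc {M A : Type*} [MeasurableSpace M] [MeasurableSpace A] (h : ℕ) :
    Measurable (fun p : (M × Traj A h) × (A × ℝ) =>
      (p.1.1, (Fin.snoc p.1.2 p.2 : Traj A (h + 1)))) := by
  refine (measurable_fst.comp measurable_fst).prodMk (measurable_pi_lambda _ fun i => ?_)
  refine Fin.lastCases ?_ (fun j => ?_) i
  · simpa using measurable_snd
  · simp only [Fin.snoc_castSucc]
    exact (measurable_pi_apply j).comp (measurable_snd.comp measurable_fst)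

theorem measurable_obs (S : BanditModel A M V) :
    Measurable (fun q : A × V => (q.1, S.reward q.2 q.1)) :=
  measurable_fst.prodMk (S.measurable_reward.comp measurable_swap)

instance (S : BanditModel A M V) (alg : BanditAlg A) (h : ℕ) :
    IsMarkovKernel (S.step alg h) := by
  have := alg.isMarkov h
  have := S.isMarkov
  exact Kernel.IsMarkovKernel.map _ S.measurable_obs

theorem isProbabilityMeasure_law (S : BanditModel A M V) (P : Measure M)
    [IsProbabilityMeasure P] (alg : BanditAlg A) (h : ℕ) :
    IsProbabilityMeasure (S.law P alg h) := by
  induction h with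
  | zero => exact Measure.isProbabilityMeasure_map (by fun_prop)
  | succ h ih => exact Measure.isProbabilityMeasure_map (measurable_snoc h).aemeasurable

theorem lintegral_step (S : BanditModel A M V) (alg : BanditAlg A) (h : ℕ) (m : M)
    (τ : Traj A h) {f : A × ℝ → ENNReal} (hf : Measurable f) :
    ∫⁻ q, f q ∂(S.step alg h (m, τ)) =
      ∫⁻ a, ∫⁻ v, f (a, S.reward v a) ∂(S.D m) ∂(alg.act h τ) := by
  have := alg.isMarkov h
  have := S.isMarkov
  rw [step, Kernel.lintegral_map _ S.measurable_obs _ hf, Kernel.prod_apply,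
    lintegral_prod (fun q : A × V => f (q.1, S.reward q.2 q.1))
      (hf.comp S.measurable_obs).aemeasurable]
  rfl

/-- The law of the reward of an action, given the mean vector. -/
def rewardKernel (S : BanditModel A M V) : Kernel (M × A) ℝ :=
  (S.D.prodMkRight A ×ₖ Kernel.deterministic Prod.snd measurable_snd).map
    (fun q : V × A => S.reward q.1 q.2)

theorem lintegral_rewardKernel (S : BanditModel A M V) (m : M) (a : A) {f : ℝ → ENNReal}
    (hf : Measurable f) :
    ∫⁻ r, f r ∂(S.rewardKernel (m, a)) = ∫⁻ v, f (S.reward v a) ∂(S.D m) := by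
  have := S.isMarkov
  rw [rewardKernel, Kernel.lintegral_map _ S.measurable_reward _ hf, Kernel.prod_apply,
    lintegral_prod (fun q : V × A => f (S.reward q.1 q.2))
      (hf.comp S.measurable_reward).aemeasurable]
  have hm : ∀ v : V, Measurable fun a' : A => f (S.reward v a') := fun v =>
    hf.comp (S.measurable_reward.comp (measurable_const.prodMk measurable_id))
  simp [Kernel.deterministic_apply, Kernel.prodMkRight_apply, lintegral_dirac' _ (hm _)]

instance (S : BanditModel A M V) : IsMarkovKernel S.rewardKernel := by
  have := S.isMarkov
  exact Kernel.IsMarkovKernel.map _ S.measurable_reward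

/-- The joint law of the next reward and the mean vector, when the mean vector is drawn from `κ`
and the next action is given. -/
def predictive (S : BanditModel A M V) {h : ℕ} (κ : Kernel (Traj A h) M) :
    Kernel (Traj A h × A) (ℝ × M) :=
  (κ.prodMkRight A ⊗ₖ
    S.rewardKernel.comap (fun p : (Traj A h × A) × M => (p.2, p.1.2)) (by fun_prop)).map Prod.swap

instance (S : BanditModel A M V) {h : ℕ} (κ : Kernel (Traj A h) M) [IsMarkovKernel κ] :
    IsMarkovKernel (S.predictive κ) := by
  exact Kernel.IsMarkovKernel.map _ measurable_swap

theorem lintegral_predictive (S : BanditModel A M V) {h : ℕ} (κ : Kernel (Traj A h) M)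
    [IsMarkovKernel κ] (τ : Traj A h) (a : A) {f : ℝ × M → ENNReal} (hf : Measurable f) :
    ∫⁻ q, f q ∂(S.predictive κ (τ, a)) =
      ∫⁻ m, ∫⁻ v, f (S.reward v a, m) ∂(S.D m) ∂(κ τ) := by
  have hf' : Measurable fun q : M × ℝ => f q.swap := hf.comp measurable_swap
  rw [predictive, Kernel.lintegral_map _ measurable_swap _ hf, Kernel.lintegral_compProd _ _ _ hf']
  refine lintegral_congr fun m => ?_
  simp only [Kernel.comap_apply, Prod.swap_prod_mk]
  exact S.lintegral_rewardKernel m a (f := fun r => f (r, m)) (by fun_prop)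

/-- Integration against the joint law at step `h + 1`. -/
theorem lintegral_law_succ (S : BanditModel A M V) (P : Measure M) [IsProbabilityMeasure P]
    (alg : BanditAlg A) (h : ℕ) (κ : Kernel (Traj A h) M) [IsMarkovKernel κ]
    (hκ : (S.law P alg h).map Prod.swap = (S.law P alg h).snd ⊗ₘ κ)
    {F : M × Traj A (h + 1) → ENNReal} (hF : Measurable F) :
    ∫⁻ p, F p ∂(S.law P alg (h + 1)) =
      ∫⁻ τ, ∫⁻ a, ∫⁻ q, F (q.2, Fin.snoc τ (a, q.1)) ∂(S.predictive κ (τ, a)) ∂(alg.act h τ)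
        ∂(S.law P alg h).snd := by
  have := S.isProbabilityMeasure_law P alg h
  have := alg.isMarkov h
  have := S.isMarkov
  have hm := measurable_snoc (M := M) (A := A) h
  have hG : Measurable fun p : (M × Traj A h) × (A × ℝ) =>
      F (p.1.1, (Fin.snoc p.1.2 p.2 : Traj A (h + 1))) := hF.comp hm
  rw [law, lintegral_map hF hm, Measure.lintegral_compProd hG]
  have hG1 : Measurable fun p : M × Traj A h =>
      ∫⁻ q, F (p.1, (Fin.snoc p.2 q : Traj A (h + 1))) ∂(S.step alg h p) :=
    hG.lintegral_kernel_prod_right'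
  have hG2 : Measurable fun z : Traj A h × M =>
      ∫⁻ q, F (z.2, (Fin.snoc z.1 q : Traj A (h + 1))) ∂(S.step alg h z.swap) :=
    hG1.comp measurable_swap
  have hswap : ∫⁻ p : M × Traj A h, ∫⁻ q, F (p.1, (Fin.snoc p.2 q : Traj A (h + 1)))
        ∂(S.step alg h p) ∂(S.law P alg h) =
      ∫⁻ z, ∫⁻ q, F (z.2, (Fin.snoc z.1 q : Traj A (h + 1))) ∂(S.step alg h z.swap)
        ∂((S.law P alg h).map Prod.swap) := by
    rw [lintegral_map hG2 measurable_swap]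
    rfl
  rw [hswap, hκ, Measure.lintegral_compProd hG2]
  refine lintegral_congr fun τ => ?_
  have hτ : ∀ m : M, Measurable fun q : A × ℝ => F (m, (Fin.snoc τ q : Traj A (h + 1))) := fun m =>
    hG.comp (measurable_const.prodMk measurable_id : Measurable fun q : A × ℝ => ((m, τ), q))
  have h1 : ∀ m : M, ∫⁻ q, F (m, (Fin.snoc τ q : Traj A (h + 1))) ∂(S.step alg h (m, τ)) =
      ∫⁻ a, ∫⁻ v, F (m, Fin.snoc τ (a, S.reward v a)) ∂(S.D m) ∂(alg.act h τ) := fun m =>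
    S.lintegral_step alg h m τ (hτ m)
  have h2 : ∀ a : A, ∫⁻ q, F (q.2, Fin.snoc τ (a, q.1)) ∂(S.predictive κ (τ, a)) =
      ∫⁻ m, ∫⁻ v, F (m, Fin.snoc τ (a, S.reward v a)) ∂(S.D m) ∂(κ τ) := fun a =>
    S.lintegral_predictive κ τ a (f := fun q => F (q.2, Fin.snoc τ (a, q.1)))
      (hG.comp (by fun_prop : Measurable fun q : ℝ × M => ((q.2, τ), (a, q.1))))
  simp only [Prod.swap_prod_mk, h1, h2]
  refine lintegral_lintegral_swap (Measurable.aemeasurable ?_)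
  have hK : Measurable fun z : (M × A) × V =>
      F (z.1.1, (Fin.snoc τ (z.1.2, S.reward z.2 z.1.2) : Traj A (h + 1))) := by
    refine hG.comp (g := fun p : (M × Traj A h) × (A × ℝ) =>
      F (p.1.1, (Fin.snoc p.1.2 p.2 : Traj A (h + 1))))
      (f := fun z : (M × A) × V => ((z.1.1, τ), (z.1.2, S.reward z.2 z.1.2))) ?_
    have := S.measurable_reward.comp
      (by fun_prop : Measurable fun z : (M × A) × V => (z.2, z.1.2))
    exact (by fun_prop : Measurable fun z : (M × A) × V => (z.1.1, τ)).prodMk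
      ((by fun_prop : Measurable fun z : (M × A) × V => z.1.2).prodMk this)
  exact hK.lintegral_kernel_prod_right' (κ := S.D.prodMkRight A)

/-- Posteriors exist (they are obtained by Bayesian updating). -/
theorem exists_isPosterior [StandardBorelSpace M] (S : BanditModel A M V) (P : Measure M)
    [IsProbabilityMeasure P] :
    ∃ κ : ∀ h : ℕ, Kernel (Traj A h) M, (∀ h, IsMarkovKernel (κ h)) ∧ S.IsPosterior P κ := by
  suffices H : ∀ h : ℕ, ∃ κ : Kernel (Traj A h) M, IsMarkovKernel κ ∧ ∀ alg : BanditAlg A,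
      (S.law P alg h).map Prod.swap = (S.law P alg h).snd ⊗ₘ κ by
    choose κ h1 h2 using H
    exact ⟨κ, h1, fun alg h => h2 h alg⟩
  have : Nonempty M := P.nonempty_of_neZero
  intro h
  induction h with
  | zero =>
    refine ⟨Kernel.const _ P, inferInstance, fun alg => ?_⟩
    have hm : Measurable fun m : M => (m, (Fin.elim0 : Traj A 0)) := by fun_prop
    rw [law, Measure.compProd_const, Measure.snd, Measure.map_map measurable_swap hm,
      Measure.map_map measurable_snd hm]
    have h1 : (Prod.snd ∘ fun m : M => (m, (Fin.elim0 : Traj A 0))) = fun _ => Fin.elim0 := rfl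
    rw [h1, Measure.map_const, measure_univ, one_smul, Measure.dirac_prod]
    rfl
  | succ h ih =>
    obtain ⟨κ, hκM, hκ⟩ := ih
    have hg : Measurable fun τ : Traj A (h + 1) =>
        (((fun i => τ i.castSucc : Traj A h), (τ (Fin.last h)).1), (τ (Fin.last h)).2) := by
      fun_prop
    refine ⟨(S.predictive κ).condKernel.comap _ hg, inferInstance, fun alg => ?_⟩
    have hL := S.isProbabilityMeasure_law P alg (h + 1)
    have := alg.isMarkov h
    refine Measure.ext_of_lintegral _ fun f hf => ?_
    have hsn : ∀ (τ : Traj A h) (a : A),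
        Measurable fun q : ℝ × M => (q.2, (Fin.snoc τ (a, q.1) : Traj A (h + 1))) := fun τ a =>
      (measurable_snoc (M := M) h).comp
        (by fun_prop : Measurable fun q : ℝ × M => ((q.2, τ), (a, q.1)))
    have hI : Measurable fun τ : Traj A (h + 1) =>
        ∫⁻ m, f (τ, m) ∂((S.predictive κ).condKernel.comap _ hg τ) :=
      hf.lintegral_kernel_prod_right'
    have hf' : Measurable fun p : M × Traj A (h + 1) => f p.swap := hf.comp measurable_swap
    have hI' : Measurable fun p : M × Traj A (h + 1) =>
        ∫⁻ m, f (p.2, m) ∂((S.predictive κ).condKernel.comap _ hg p.2) := hI.comp measurable_snd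
    rw [lintegral_map hf measurable_swap, Measure.lintegral_compProd hf, Measure.snd,
      lintegral_map hI measurable_snd,
      S.lintegral_law_succ P alg h κ (hκ alg) hf',
      S.lintegral_law_succ P alg h κ (hκ alg) hI']
    refine lintegral_congr fun τ => lintegral_congr fun a => ?_
    have hA : Measurable fun q : ℝ × M => f ((Fin.snoc τ (a, q.1) : Traj A (h + 1)), q.2) :=
      hf'.comp (hsn τ a)
    have key := (S.predictive κ).disintegrate (S.predictive κ).condKernel
    conv_lhs => rw [← key]
    simp only [Prod.swap_prod_mk]
    rw [Kernel.lintegral_compProd _ _ _ hA]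
    rw [Kernel.lintegral_fst _ _ ?_]
    · simp
    · exact hA.lintegral_kernel_prod_right'
        (κ := (S.predictive κ).condKernel.comap (fun r : ℝ => ((τ, a), r)) (by fun_prop))

end BanditModel

end

/-!
The regret gap is controlled by the total variation distance between the laws of what the two
algorithms generate when the data really come from `P θ`.

Fix an algorithm and write `ε` for the distance of the two priors. Running the algorithm is a
Markov kernel, so the laws of (mean vector, trajectory of length `h`) under the two priors are
`ε`-close. Disintegrating each law along its own posterior, and then replacing the trajectory
marginal of the second by that of the first, shows that the two posteriors, averaged over the
trajectories of the true environment, are `2 ε`-close, and `ε`-close for `h = 0`, where there is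
only one trajectory (`BanditModel.tvClose_posterior`). Since an action of Thompson sampling is a
function, up to independent randomization, of a posterior sample, and is independent of the mean
vector given the trajectory, switching the algorithm at one step moves the joint law of mean
vector, trajectory and next action by at most the same amount
(`BanditModel.tvClose_actionLaw_step`). Summing over the steps, the joint laws of the mean vector
and the action number `h + 1` under the two algorithms are `(2 h + 1) ε`-close
(`BanditModel.tvClose_actionLaw`).

The expected reward of that action is the expectation of its mean. Both laws have the same marginal
on mean vectors, so the mean of a fixed reference action may be subtracted; the difference lies in
`[-B, B]`, so that the two expectations differ by at most `2 B (2 h + 1) ε`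
(`BanditModel.abs_integral_mean_sub_le`). Finally `∑_{h < H} (2 h + 1) = H ^ 2`. Comparing with a
fixed action, rather than with the infimum over the actions, avoids the question whether this
infimum is measurable, and its loss of a factor `2` is made up for by the saving at `h = 0`.
-/

open MeasureTheory ProbabilityTheory

/-! ### Closeness in total variation -/

/-- The measures `P` and `Q` differ by at most `t` on every measurable event; for probability
measures, their total variation distance is at most `t`. -/
def TVClose {Ω : Type*} [MeasurableSpace Ω] (P Q : Measure Ω) (t : ℝ) : Prop :=
  ∀ E : Set Ω, MeasurableSet E → |P.real E - Q.real E| ≤ t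

namespace TVClose

variable {Ω Ω' : Type*} [MeasurableSpace Ω] [MeasurableSpace Ω'] {P Q : Measure Ω} {t : ℝ}

theorem of_tvDist (P Q : Measure Ω) [IsProbabilityMeasure P] [IsProbabilityMeasure Q] :
    TVClose P Q (tvDist P Q) := by
  intro E hE
  refine le_ciSup (f := fun E : {E : Set Ω // MeasurableSet E} => |P.real E.1 - Q.real E.1|)
    ⟨1, ?_⟩ ⟨E, hE⟩
  rintro _ ⟨E, rfl⟩
  have h1 := measureReal_le_one (μ := P) (s := E.1)
  have h2 := measureReal_le_one (μ := Q) (s := E.1)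
  have h3 := measureReal_nonneg (μ := P) (s := E.1)
  have h4 := measureReal_nonneg (μ := Q) (s := E.1)
  exact abs_le.2 ⟨by linarith, by linarith⟩

theorem refl (P : Measure Ω) : TVClose P P 0 := fun E _ => by simp

theorem symm (h : TVClose P Q t) : TVClose Q P t := fun E hE => by
  rw [abs_sub_comm]
  exact h E hE

theorem trans {R : Measure Ω} {s : ℝ} (h : TVClose P Q t) (h' : TVClose Q R s) :
    TVClose P R (t + s) := fun E hE =>
  (abs_sub_le _ (Q.real E) _).trans (add_le_add (h E hE) (h' E hE))

theorem map (h : TVClose P Q t) {f : Ω → Ω'} (hf : Measurable f) :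
    TVClose (P.map f) (Q.map f) t := fun E hE => by
  rw [map_measureReal_apply hf hE, map_measureReal_apply hf hE]
  exact h _ (hf hE)

/-- By the layer cake formula, an integral is an average of probabilities of level sets. -/
theorem abs_integral_sub_le [IsFiniteMeasure P] [IsFiniteMeasure Q] (h : TVClose P Q t)
    {f : Ω → ℝ} (hf : Measurable f) {c : ℝ} (h0 : ∀ x, 0 ≤ f x) (hc : ∀ x, f x ≤ c)
    (hc0 : 0 ≤ c) : |∫ x, f x ∂P - ∫ x, f x ∂Q| ≤ t * c := by
  have key : ∀ (μ : Measure Ω) [IsFiniteMeasure μ],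
      ∫ x, f x ∂μ = ∫ s in Set.Ioc 0 c, μ.real {x | s < f x} := by
    intro μ _
    have hi : Integrable f μ := Integrable.of_bound hf.aestronglyMeasurable c
      (.of_forall fun x => by rw [Real.norm_of_nonneg (h0 x)]; exact hc x)
    rw [hi.integral_eq_integral_meas_lt (.of_forall h0)]
    refine (setIntegral_eq_of_subset_of_forall_sdiff_eq_zero measurableSet_Ioi
      Set.Ioc_subset_Ioi_self fun s hs => ?_)
    have hs' : c < s := by
      by_contra hcs
      exact hs.2 ⟨hs.1, not_lt.1 hcs⟩
    have : {x | s < f x} = ∅ := by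
      ext x
      simpa using (hc x).trans hs'.le
    simp [this]
  have hint : ∀ (μ : Measure Ω) [IsFiniteMeasure μ],
      IntegrableOn (fun s => μ.real {x | s < f x}) (Set.Ioc 0 c) := by
    intro μ _
    have hanti : Antitone fun s => μ.real {x | s < f x} := fun s s' hs =>
      measureReal_mono fun x hx => lt_of_le_of_lt hs hx
    exact (hanti.antitoneOn _).integrableOn_isCompact isCompact_Icc |>.mono_set
      Set.Ioc_subset_Icc_self
  rw [key P, key Q, ← integral_sub (hint P) (hint Q)]
  have := norm_setIntegral_le_of_norm_le_const (μ := volume) (s := Set.Ioc 0 c) (C := t)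
    (f := fun s => P.real {x | s < f x} - Q.real {x | s < f x}) (by simp)
    (fun s _ => h _ (measurableSet_lt measurable_const hf))
  simpa [Real.volume_real_Ioc_of_le hc0] using this

theorem compProd [IsFiniteMeasure P] [IsFiniteMeasure Q] (h : TVClose P Q t)
    (κ : Kernel Ω Ω') [IsMarkovKernel κ] : TVClose (P ⊗ₘ κ) (Q ⊗ₘ κ) t := by
  intro E hE
  have key : ∀ (μ : Measure Ω) [IsFiniteMeasure μ],
      (μ ⊗ₘ κ).real E = ∫ x, (κ x).real (Prod.mk x ⁻¹' E) ∂μ := by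
    intro μ _
    rw [measureReal_def, Measure.compProd_apply hE]
    exact (integral_toReal (Kernel.measurable_kernel_prodMk_left hE).aemeasurable
      (.of_forall fun x => measure_lt_top _ _)).symm
  rw [key P, key Q]
  have := h.abs_integral_sub_le (f := fun x => (κ x).real (Prod.mk x ⁻¹' E)) (c := 1)
    (Kernel.measurable_kernel_prodMk_left hE).ennreal_toReal (fun x => measureReal_nonneg)
    (fun x => measureReal_le_one) zero_le_one
  simpa using this

/-- Functions that are only almost surely bounded by `B` in absolute value. -/
theorem abs_integral_sub_le_of_abs_le [IsProbabilityMeasure P] [IsProbabilityMeasure Q]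
    (h : TVClose P Q t) {f : Ω → ℝ} (hf : Measurable f) {B : ℝ} (hB : 0 ≤ B)
    (hP : ∀ᵐ x ∂P, |f x| ≤ B) (hQ : ∀ᵐ x ∂Q, |f x| ≤ B) :
    |∫ x, f x ∂P - ∫ x, f x ∂Q| ≤ t * (2 * B) := by
  -- `g` is `f` clamped to `[-B, B]` and shifted to `[0, 2 B]`.
  set g : Ω → ℝ := fun x => max (-B) (min B (f x)) + B with hg
  have hgm : Measurable g := (measurable_const.max (measurable_const.min hf)).add_const B
  have key : ∀ (μ : Measure Ω) [IsProbabilityMeasure μ], (∀ᵐ x ∂μ, |f x| ≤ B) →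
      ∫ x, g x ∂μ = ∫ x, f x ∂μ + B := by
    intro μ _ hμ
    have hi : Integrable f μ := Integrable.of_bound hf.aestronglyMeasurable B hμ
    have : g =ᵐ[μ] fun x => f x + B := by
      filter_upwards [hμ] with x hx
      rw [hg]
      simp [min_eq_right (abs_le.1 hx).2, max_eq_right (abs_le.1 hx).1]
    rw [integral_congr_ae this, integral_add hi (integrable_const _)]
    simp
  have := h.abs_integral_sub_le hgm (c := 2 * B)
    (fun x => by have := le_max_left (-B) (min B (f x)); simp only [hg]; linarith)
    (fun x => by
      have : max (-B) (min B (f x)) ≤ B := max_le (by linarith) (min_le_left _ _)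
      simp only [hg]; linarith) (by linarith)
  rw [key P hP, key Q hQ] at this
  simpa using this

end TVClose

theorem abs_sub_le_of_vecDiam_le {A : Type*} {μ : A → ℝ} {B : ℝ} (h : vecDiam μ ≤ (B : EReal))
    (a b : A) : |μ a - μ b| ≤ B := by
  have key : ∀ a b : A, μ a - μ b ≤ B := by
    intro a b
    have h1 : ((μ a : EReal) - (μ b : EReal)) ≤ vecDiam μ :=
      EReal.sub_le_sub (le_iSup (fun a => (μ a : EReal)) a) (iInf_le (fun a => (μ a : EReal)) b)
    exact_mod_cast h1.trans h
  exact abs_le.2 ⟨by linarith [key b a], key a b⟩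

namespace BanditModel

variable {A M V : Type*} [MeasurableSpace A] [MeasurableSpace M] [MeasurableSpace V]

/-! ### The joint law of mean vector, trajectory and next action -/

/-- The joint law of the mean vector, the trajectory of length `h`, and the action that follows. -/
noncomputable def actionLaw (S : BanditModel A M V) (P : Measure M) (alg : BanditAlg A) (h : ℕ) :
    Measure ((M × Traj A h) × A) :=
  S.law P alg h ⊗ₘ (alg.act h).prodMkLeft M

theorem isProbabilityMeasure_actionLaw (S : BanditModel A M V) (P : Measure M)
    [IsProbabilityMeasure P] (alg : BanditAlg A) (h : ℕ) :
    IsProbabilityMeasure (S.actionLaw P alg h) := by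
  have := S.isProbabilityMeasure_law P alg h
  have := alg.isMarkov h
  exact inferInstanceAs (IsProbabilityMeasure (_ ⊗ₘ _))

/-- The reward that follows an action is drawn from the reward kernel. -/
noncomputable def nextReward (S : BanditModel A M V) (h : ℕ) : Kernel ((M × Traj A h) × A) ℝ :=
  S.rewardKernel.comap (fun p => (p.1.1, p.2)) (by fun_prop)

instance (S : BanditModel A M V) (h : ℕ) : IsMarkovKernel (S.nextReward h) :=
  inferInstanceAs (IsMarkovKernel (S.rewardKernel.comap _ _))

theorem measurable_snoc_reward (h : ℕ) :
    Measurable (fun q : ((M × Traj A h) × A) × ℝ =>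
      (q.1.1.1, (Fin.snoc q.1.1.2 (q.1.2, q.2) : Traj A (h + 1)))) :=
  (measurable_snoc (M := M) (A := A) h).comp
    (by fun_prop : Measurable fun q : ((M × Traj A h) × A) × ℝ => (q.1.1, (q.1.2, q.2)))

theorem law_zero (S : BanditModel A M V) (P : Measure M) (alg : BanditAlg A) :
    S.law P alg 0 = P.map (fun m => (m, Fin.elim0)) := rfl

theorem law_succ_eq_map (S : BanditModel A M V) (P : Measure M) [IsProbabilityMeasure P]
    (alg : BanditAlg A) (h : ℕ) :
    S.law P alg (h + 1) = (S.actionLaw P alg h ⊗ₘ S.nextReward h).map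
      (fun q => (q.1.1.1, (Fin.snoc q.1.1.2 (q.1.2, q.2) : Traj A (h + 1)))) := by
  have := S.isProbabilityMeasure_law P alg h
  have := S.isProbabilityMeasure_actionLaw P alg h
  have := alg.isMarkov h
  refine Measure.ext_of_lintegral _ fun F hF => ?_
  have hG : Measurable fun p : (M × Traj A h) × (A × ℝ) =>
      F (p.1.1, (Fin.snoc p.1.2 p.2 : Traj A (h + 1))) := hF.comp (measurable_snoc h)
  have hG' : Measurable fun q : ((M × Traj A h) × A) × ℝ =>
      F (q.1.1.1, (Fin.snoc q.1.1.2 (q.1.2, q.2) : Traj A (h + 1))) :=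
    hF.comp (measurable_snoc_reward h)
  rw [law, lintegral_map hF (measurable_snoc h), Measure.lintegral_compProd hG,
    lintegral_map hF (measurable_snoc_reward h), Measure.lintegral_compProd hG', actionLaw,
    Measure.lintegral_compProd hG'.lintegral_kernel_prod_right']
  refine lintegral_congr fun p => ?_
  rw [S.lintegral_step alg h p.1 p.2
    (f := fun q => F (p.1, (Fin.snoc p.2 q : Traj A (h + 1)))) (hG.comp measurable_prodMk_left)]
  refine lintegral_congr fun a => ?_
  exact (S.lintegral_rewardKernel p.1 a
    (hG'.comp (measurable_prodMk_left (x := (p, a))))).symm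

theorem law_succ_map_init (S : BanditModel A M V) (P : Measure M) [IsProbabilityMeasure P]
    (alg : BanditAlg A) (h : ℕ) :
    (S.law P alg (h + 1)).map (fun p => (p.1, fun i : Fin h => p.2 i.castSucc)) =
      S.law P alg h := by
  have := S.isProbabilityMeasure_law P alg h
  rw [law, Measure.map_map (by fun_prop) (measurable_snoc h)]
  have : ((fun p : M × Traj A (h + 1) => (p.1, fun i : Fin h => p.2 i.castSucc)) ∘
      fun p : (M × Traj A h) × (A × ℝ) => (p.1.1, (Fin.snoc p.1.2 p.2 : Traj A (h + 1)))) =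
      Prod.fst := by
    ext p <;> simp
  rw [this]
  exact Measure.fst_compProd _ _

theorem law_fst (S : BanditModel A M V) (P : Measure M) [IsProbabilityMeasure P]
    (alg : BanditAlg A) (h : ℕ) : (S.law P alg h).map Prod.fst = P := by
  induction h with
  | zero =>
    rw [law, Measure.map_map measurable_fst (by fun_prop)]
    exact Measure.map_id
  | succ h ih =>
    rw [← S.law_succ_map_init P alg h, Measure.map_map measurable_fst (by fun_prop)] at ih
    exact ih

theorem actionLaw_fst (S : BanditModel A M V) (P : Measure M) [IsProbabilityMeasure P]
    (alg : BanditAlg A) (h : ℕ) :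
    (S.actionLaw P alg h).map (fun p => p.1.1) = P := by
  have := S.isProbabilityMeasure_law P alg h
  have := alg.isMarkov h
  have h1 : (S.actionLaw P alg h).map Prod.fst = S.law P alg h := Measure.fst_compProd _ _
  have h2 := S.law_fst P alg h
  rw [← h1, Measure.map_map measurable_fst measurable_fst] at h2
  exact h2

/-! ### Total variation along the protocol -/

theorem tvClose_law_succ (S : BanditModel A M V) {P P' : Measure M} [IsProbabilityMeasure P]
    [IsProbabilityMeasure P'] {alg alg' : BanditAlg A} {h : ℕ} {t : ℝ}
    (ht : TVClose (S.actionLaw P alg h) (S.actionLaw P' alg' h) t) :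
    TVClose (S.law P alg (h + 1)) (S.law P' alg' (h + 1)) t := by
  have := S.isProbabilityMeasure_actionLaw P alg h
  have := S.isProbabilityMeasure_actionLaw P' alg' h
  rw [law_succ_eq_map, law_succ_eq_map]
  exact (ht.compProd _).map (measurable_snoc_reward h)

/-- The same algorithm run on two priors: no step increases the total variation distance. -/
theorem tvClose_law_of_prior (S : BanditModel A M V) {P P' : Measure M} [IsProbabilityMeasure P]
    [IsProbabilityMeasure P'] {ε : ℝ} (hε : TVClose P P' ε) (alg : BanditAlg A) (h : ℕ) :
    TVClose (S.law P alg h) (S.law P' alg h) ε := by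
  induction h with
  | zero => exact hε.map (by fun_prop)
  | succ h ih =>
    have := S.isProbabilityMeasure_law P alg h
    have := S.isProbabilityMeasure_law P' alg h
    have := alg.isMarkov h
    exact S.tvClose_law_succ (ih.compProd _)

/-- The posteriors of two priors are close on average over the trajectories generated by an
algorithm under the first prior. -/
theorem tvClose_posterior (S : BanditModel A M V) {P P' : Measure M} [IsProbabilityMeasure P]
    [IsProbabilityMeasure P'] {κ κ' : ∀ h : ℕ, Kernel (Traj A h) M} [∀ h, IsMarkovKernel (κ' h)]
    (hκ : S.IsPosterior P κ) (hκ' : S.IsPosterior P' κ') (alg : BanditAlg A) {h : ℕ} {ε δ : ℝ}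
    (hε : TVClose P P' ε)
    (hδ : TVClose (S.law P alg h).snd (S.law P' alg h).snd δ) :
    TVClose ((S.law P alg h).snd ⊗ₘ κ h) ((S.law P alg h).snd ⊗ₘ κ' h) (ε + δ) := by
  have := S.isProbabilityMeasure_law P alg h
  have := S.isProbabilityMeasure_law P' alg h
  have h1 := (S.tvClose_law_of_prior hε alg h).map measurable_swap
  rw [hκ alg h, hκ' alg h] at h1
  exact h1.trans (hδ.symm.compProd _)

theorem compProd_comp_eq_map {X Y Z : Type*} [MeasurableSpace X] [MeasurableSpace Y]
    [MeasurableSpace Z] (ν : Measure X) [IsFiniteMeasure ν] (κ : Kernel X Y) [IsMarkovKernel κ]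
    (η : Kernel Y Z) [IsMarkovKernel η] :
    ν ⊗ₘ (η ∘ₖ κ) = ((ν ⊗ₘ κ) ⊗ₘ η.prodMkLeft X).map (fun p => (p.1.1, p.2)) := by
  refine Measure.ext_of_lintegral _ fun F hF => ?_
  have hF' : Measurable fun p : (X × Y) × Z => F (p.1.1, p.2) := hF.comp (by fun_prop)
  rw [Measure.lintegral_compProd hF, lintegral_map hF (by fun_prop),
    Measure.lintegral_compProd hF', Measure.lintegral_compProd hF'.lintegral_kernel_prod_right']
  refine lintegral_congr fun x => ?_
  rw [Kernel.lintegral_comp _ _ _ (g := fun z => F (x, z)) (hF.comp measurable_prodMk_left)]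
  rfl

/-- Given the trajectory, the next action is independent of the mean vector: the trajectory may be
drawn first, then the action, and then the mean vector from the posterior. -/
theorem compProd_prodMkLeft_eq_map {X Y Z : Type*} [MeasurableSpace X] [MeasurableSpace Y]
    [MeasurableSpace Z] {L : Measure (Y × X)} [IsFiniteMeasure L] {κ : Kernel X Y}
    [IsMarkovKernel κ] (hκ : L.map Prod.swap = L.snd ⊗ₘ κ) (η : Kernel X Z) [IsMarkovKernel η] :
    L ⊗ₘ η.prodMkLeft Y =
      ((L.snd ⊗ₘ η) ⊗ₘ κ.prodMkRight Z).map (fun p => ((p.2, p.1.1), p.1.2)) := by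
  refine Measure.ext_of_lintegral _ fun F hF => ?_
  have hF' : Measurable fun p : (X × Z) × Y => F ((p.2, p.1.1), p.1.2) := hF.comp (by fun_prop)
  have hF2 : Measurable fun z : X × Y => ∫⁻ a, F (z.swap, a) ∂(η z.1) :=
    (hF.lintegral_kernel_prod_right' (κ := η.prodMkLeft Y)).comp measurable_swap
  have hL : ∫⁻ p, ∫⁻ a, F (p, a) ∂(η.prodMkLeft Y p) ∂L =
      ∫⁻ z, ∫⁻ a, F (z.swap, a) ∂(η z.1) ∂(L.map Prod.swap) := by
    rw [lintegral_map hF2 measurable_swap]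
    rfl
  rw [Measure.lintegral_compProd hF, hL, hκ, Measure.lintegral_compProd hF2,
    lintegral_map hF (by fun_prop), Measure.lintegral_compProd hF',
    Measure.lintegral_compProd hF'.lintegral_kernel_prod_right']
  refine lintegral_congr fun x => ?_
  exact lintegral_lintegral_swap (μ := κ x) (ν := η x)
    (f := fun y z => F ((y, x), z))
    (hF.comp (by fun_prop : Measurable fun q : Y × Z => ((q.1, x), q.2))).aemeasurable

variable {P P' : Measure M} [IsProbabilityMeasure P] [IsProbabilityMeasure P']
  {κ κ' : ∀ h : ℕ, Kernel (Traj A h) M} [∀ h, IsMarkovKernel (κ h)] [∀ h, IsMarkovKernel (κ' h)]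
  (sel : Kernel M A) [IsMarkovKernel sel]

/-- One step of the comparison: the distance of the laws of the past is increased by at most the
average distance of the posteriors. -/
theorem tvClose_actionLaw_step (S : BanditModel A M V) (hκ : S.IsPosterior P κ)
    (hκ' : S.IsPosterior P' κ') {h : ℕ} {ε δ t : ℝ} (hε : TVClose P P' ε)
    (hδ : TVClose (S.law P (thompsonSampling κ sel) h).snd
      (S.law P' (thompsonSampling κ sel) h).snd δ)
    (ht : TVClose (S.law P (thompsonSampling κ sel) h) (S.law P (thompsonSampling κ' sel) h) t) :
    TVClose (S.actionLaw P (thompsonSampling κ sel) h)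
      (S.actionLaw P (thompsonSampling κ' sel) h) (ε + δ + t) := by
  have := S.isProbabilityMeasure_law P (thompsonSampling κ sel) h
  have := S.isProbabilityMeasure_law P (thompsonSampling κ' sel) h
  -- The intermediate law follows `κ` up to step `h` and draws the next action according to `κ'`.
  refine TVClose.trans (Q := S.law P (thompsonSampling κ sel) h ⊗ₘ
    (sel ∘ₖ κ' h).prodMkLeft M) ?_ (ht.compProd _)
  change TVClose (S.law P (thompsonSampling κ sel) h ⊗ₘ (sel ∘ₖ κ h).prodMkLeft M) _ _
  rw [compProd_prodMkLeft_eq_map (hκ _ h), compProd_prodMkLeft_eq_map (hκ _ h)]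
  refine TVClose.map (TVClose.compProd ?_ _) (by fun_prop)
  rw [compProd_comp_eq_map, compProd_comp_eq_map]
  exact ((S.tvClose_posterior hκ hκ' _ hε hδ).compProd _).map (by fun_prop)

theorem tvClose_actionLaw (S : BanditModel A M V) (hκ : S.IsPosterior P κ)
    (hκ' : S.IsPosterior P' κ') {ε : ℝ} (hε : TVClose P P' ε) (h : ℕ) :
    TVClose (S.actionLaw P (thompsonSampling κ sel) h)
      (S.actionLaw P (thompsonSampling κ' sel) h) ((2 * h + 1) * ε) := by
  induction h with
  | zero =>
    -- Trajectories of length `0` carry no information, so that their laws coincide.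
    have hδ : (S.law P (thompsonSampling κ sel) 0).snd =
        (S.law P' (thompsonSampling κ sel) 0).snd := by
      have := S.isProbabilityMeasure_law P (thompsonSampling κ sel) 0
      have := S.isProbabilityMeasure_law P' (thompsonSampling κ sel) 0
      refine Measure.ext fun s _ => ?_
      rcases Set.eq_empty_or_nonempty s with rfl | hs
      · simp
      · rw [Subsingleton.eq_univ_of_nonempty hs, measure_univ, measure_univ]
    have := S.tvClose_actionLaw_step sel hκ hκ' hε (h := 0) (δ := 0)
      (by rw [hδ]; exact TVClose.refl _)
      (by rw [law_zero, law_zero]; exact TVClose.refl _)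
    simpa only [add_zero, Nat.cast_zero, mul_zero, zero_add, one_mul] using this
  | succ h ih =>
    have := S.tvClose_actionLaw_step sel hκ hκ' hε
      ((S.tvClose_law_of_prior hε _ (h + 1)).map measurable_snd) (S.tvClose_law_succ ih)
    have hc : ε + ε + (2 * (h : ℝ) + 1) * ε = (2 * ((h + 1 : ℕ) : ℝ) + 1) * ε := by
      push_cast
      ring
    rwa [hc] at this

/-! ### Expected rewards -/

theorem integral_nextReward (S : BanditModel A M V) {h : ℕ} (p : (M × Traj A h) × A) :
    ∫ r, r ∂(S.nextReward h p) = S.mean p.1.1 p.2 := by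
  have hm : Measurable fun v => S.reward v p.2 :=
    S.measurable_reward.comp (measurable_id.prodMk measurable_const)
  have : S.nextReward h p = (S.D p.1.1).map fun v => S.reward v p.2 := by
    refine Measure.ext_of_lintegral _ fun f hf => ?_
    rw [lintegral_map hf hm]
    exact S.lintegral_rewardKernel p.1.1 p.2 hf
  rw [this, integral_map hm.aemeasurable (by fun_prop), S.integral_reward]

theorem integrable_init_iff (S : BanditModel A M V) (P : Measure M) [IsProbabilityMeasure P]
    (alg : BanditAlg A) {h : ℕ} (i : Fin h) :
    Integrable (fun p : M × Traj A (h + 1) => (p.2 i.castSucc).2) (S.law P alg (h + 1)) ↔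
      Integrable (fun p : M × Traj A h => (p.2 i).2) (S.law P alg h) := by
  conv_rhs => rw [← S.law_succ_map_init P alg h]
  exact (integrable_map_measure
    (by fun_prop : Measurable fun p : M × Traj A h => (p.2 i).2).aestronglyMeasurable
    (by fun_prop : Measurable fun p : M × Traj A (h + 1) =>
      (p.1, fun i : Fin h => p.2 i.castSucc)).aemeasurable).symm

theorem FiniteReward.init {S : BanditModel A M V} {alg : BanditAlg A}
    {H : ℕ} (hR : S.FiniteReward P alg (H + 1)) : S.FiniteReward P alg H := fun i =>
  (S.integrable_init_iff P alg i).1 (hR i.castSucc)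

/-- The last reward, as a function on the space where its action is drawn first. -/
theorem FiniteReward.integrable_last {S : BanditModel A M V} {alg : BanditAlg A}
    {H : ℕ} (hR : S.FiniteReward P alg (H + 1)) :
    Integrable (fun q : ((M × Traj A H) × A) × ℝ => q.2)
      (S.actionLaw P alg H ⊗ₘ S.nextReward H) := by
  have h1 := hR (Fin.last H)
  rw [law_succ_eq_map, integrable_map_measure
    (by fun_prop : Measurable fun p : M × Traj A (H + 1) =>
      (p.2 (Fin.last H)).2).aestronglyMeasurable
    (measurable_snoc_reward H).aemeasurable] at h1
  refine h1.congr (.of_forall fun q => ?_)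
  simp

theorem FiniteReward.integrable_mean {S : BanditModel A M V} {alg : BanditAlg A}
    {H : ℕ} (hR : S.FiniteReward P alg (H + 1)) :
    Integrable (fun p => S.mean p.1.1 p.2) (S.actionLaw P alg H) := by
  have := S.isProbabilityMeasure_actionLaw P alg H
  refine Integrable.congr (Integrable.integral_compProd hR.integrable_last) (.of_forall fun p => ?_)
  exact S.integral_nextReward p

theorem R_succ {S : BanditModel A M V} {alg : BanditAlg A} {H : ℕ}
    (hR : S.FiniteReward P alg (H + 1)) :
    S.R P alg (H + 1) = S.R P alg H + ∫ p, S.mean p.1.1 p.2 ∂(S.actionLaw P alg H) := by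
  have := S.isProbabilityMeasure_actionLaw P alg H
  have hlast : ∫ p, (p.2 (Fin.last H)).2 ∂(S.law P alg (H + 1)) =
      ∫ p, S.mean p.1.1 p.2 ∂(S.actionLaw P alg H) := by
    rw [law_succ_eq_map, integral_map (measurable_snoc_reward H).aemeasurable
      (by fun_prop : Measurable fun p : M × Traj A (H + 1) =>
        (p.2 (Fin.last H)).2).aestronglyMeasurable]
    simp only [Fin.snoc_last]
    rw [Measure.integral_compProd hR.integrable_last]
    exact integral_congr_ae (.of_forall fun p => S.integral_nextReward p)
  have hinit : ∫ p, ∑ i : Fin H, (p.2 i.castSucc).2 ∂(S.law P alg (H + 1)) = S.R P alg H := by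
    rw [R, ← S.law_succ_map_init P alg H, integral_map (by fun_prop)
      (by fun_prop : Measurable fun p : M × Traj A H => ∑ i, (p.2 i).2).aestronglyMeasurable]
  rw [R, ← hlast, ← hinit, ← integral_add (integrable_finsetSum _ fun i _ => hR i.castSucc)
    (hR (Fin.last H))]
  simp only [Fin.sum_univ_castSucc]

/-- If the next actions of two algorithms have close laws, jointly with the mean vector, then their
expected means are close, although the mean vectors themselves need not be bounded. -/
theorem abs_integral_mean_sub_le (S : BanditModel A M V) {B : ℝ} (hB : S.IsBoundedPrior P B)
    {alg alg' : BanditAlg A} {h : ℕ} {t : ℝ}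
    (ht : TVClose (S.actionLaw P alg h) (S.actionLaw P alg' h) t)
    (hi : Integrable (fun p => S.mean p.1.1 p.2) (S.actionLaw P alg h))
    (hi' : Integrable (fun p => S.mean p.1.1 p.2) (S.actionLaw P alg' h)) :
    |∫ p, S.mean p.1.1 p.2 ∂(S.actionLaw P alg h) -
      ∫ p, S.mean p.1.1 p.2 ∂(S.actionLaw P alg' h)| ≤ t * (2 * B) := by
  have := S.isProbabilityMeasure_actionLaw P alg h
  have := S.isProbabilityMeasure_actionLaw P alg' h
  obtain ⟨_, a₀⟩ := (S.actionLaw P alg h).nonempty_of_neZero.some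
  obtain ⟨m₀, hm₀⟩ := hB.exists
  have hB0 : 0 ≤ B := (abs_nonneg _).trans (abs_sub_le_of_vecDiam_le hm₀ a₀ a₀)
  have hg : Measurable fun m => S.mean m a₀ :=
    S.measurable_mean.comp (measurable_id.prodMk measurable_const)
  have hf : Measurable fun p : (M × Traj A h) × A => S.mean p.1.1 p.2 - S.mean p.1.1 a₀ :=
    (S.measurable_mean.comp (by fun_prop : Measurable fun p : (M × Traj A h) × A =>
      (p.1.1, p.2))).sub (hg.comp (by fun_prop))
  have hbound : ∀ alg : BanditAlg A,
      ∀ᵐ p ∂(S.actionLaw P alg h), |S.mean p.1.1 p.2 - S.mean p.1.1 a₀| ≤ B := by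
    intro alg
    have h1 : ∀ᵐ m ∂((S.actionLaw P alg h).map fun p => p.1.1),
        vecDiam (S.mean m) ≤ (B : EReal) := by
      rw [S.actionLaw_fst]
      exact hB
    filter_upwards [ae_of_ae_map (by fun_prop) h1] with p hp
    exact abs_sub_le_of_vecDiam_le hp _ _
  have hdiff : ∀ alg : BanditAlg A,
      Integrable (fun p => S.mean p.1.1 p.2) (S.actionLaw P alg h) →
      ∫ p, S.mean p.1.1 p.2 ∂(S.actionLaw P alg h) =
        ∫ p, (S.mean p.1.1 p.2 - S.mean p.1.1 a₀) ∂(S.actionLaw P alg h) +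
          ∫ m, S.mean m a₀ ∂P := by
    intro alg hi
    have := S.isProbabilityMeasure_actionLaw P alg h
    have hfi : Integrable (fun p => S.mean p.1.1 p.2 - S.mean p.1.1 a₀) (S.actionLaw P alg h) :=
      Integrable.of_bound hf.aestronglyMeasurable B (hbound alg)
    have hgi : Integrable (fun p => S.mean p.1.1 a₀) (S.actionLaw P alg h) :=
      (hi.sub hfi).congr (.of_forall fun p => by simp)
    have hgP : ∫ m, S.mean m a₀ ∂P = ∫ p, S.mean p.1.1 a₀ ∂(S.actionLaw P alg h) := by
      conv_lhs => rw [← S.actionLaw_fst P alg h]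
      exact integral_map (by fun_prop) hg.aestronglyMeasurable
    rw [hgP, ← integral_add hfi hgi]
    simp
  rw [hdiff alg hi, hdiff alg' hi', add_sub_add_right_eq_sub]
  exact ht.abs_integral_sub_le_of_abs_le hf hB0 (hbound alg) (hbound alg')

theorem abs_R_thompsonSampling_sub_le (S : BanditModel A M V) (hκ : S.IsPosterior P κ)
    (hκ' : S.IsPosterior P' κ') {ε : ℝ} (hε : TVClose P P' ε) {B : ℝ}
    (hB : S.IsBoundedPrior P B) (H : ℕ)
    (hR : S.FiniteReward P (thompsonSampling κ sel) H)
    (hR' : S.FiniteReward P (thompsonSampling κ' sel) H) :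
    |S.R P (thompsonSampling κ sel) H - S.R P (thompsonSampling κ' sel) H| ≤
      2 * (H : ℝ) ^ 2 * ε * B := by
  induction H with
  | zero => simp [R]
  | succ H ih =>
    have h1 := ih hR.init hR'.init
    have h2 := S.abs_integral_mean_sub_le hB (S.tvClose_actionLaw sel hκ hκ' hε H)
      hR.integrable_mean hR'.integrable_mean
    rw [R_succ hR, R_succ hR', add_sub_add_comm]
    calc _ ≤ _ := abs_add_le _ _
      _ ≤ _ := add_le_add h1 h2
      _ = _ := by push_cast; ring

end BanditModel

theorem mainTheorem4 {A M V Θ : Type*}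
    [MeasurableSpace A] [StandardBorelSpace A]
    [MeasurableSpace M] [StandardBorelSpace M]
    [MeasurableSpace V]
    (S : BanditModel A M V)
    (P : Θ → Measure M) [∀ θ, IsProbabilityMeasure (P θ)]
    (post : Θ → ∀ h : ℕ, Kernel (Traj A h) M) [∀ θ h, IsMarkovKernel (post θ h)]
    (hpost : ∀ θ, S.IsPosterior (P θ) (post θ))
    (sel : Kernel M A) [IsMarkovKernel sel] (hsel : S.IsArgmaxRule sel)
    (H : ℕ) (θ θ' : Θ) (B : ℝ) (hB : S.IsBoundedPrior (P θ) B)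
    (hR : S.FiniteReward (P θ) (thompsonSampling (post θ) sel) H)
    (hR' : S.FiniteReward (P θ) (thompsonSampling (post θ') sel) H) :
    |S.R (P θ) (thompsonSampling (post θ) sel) H - S.R (P θ) (thompsonSampling (post θ') sel) H|
      ≤ 2 * (H : ℝ) ^ 2 * tvDist (P θ) (P θ') * B := by
  exact S.abs_R_thompsonSampling_sub_le sel (hpost θ) (hpost θ') (TVClose.of_tvDist _ _) hB H hR hR'
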